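/- Let $k$ be a commutative ring and $A$ a (unital associative) $k$-algebra. A (left) gabi-algebra structure on $A$ consists of $k$-algebra maps $\varepsilon\colon A\to k$ and $\delta\colon A\to A\otimes_k A^{\mathrm{op}}$, written $\delta(a)=a_+\otimes a_-$ (summation understood), such that for all $a\in A$ $$a_+\varepsilon(a_-)=a,\qquad a_+a_-=\varepsilon(a)1_A,\qquad a_{++}\otimes a_{-+}\otimes a_{--}a_{+-}=a_+\otimes a_-\otimes 1 .$$ Given such a structure, the category $A\text{-}\mathrm{Mod}$ of left $A$-modules is skew-closed as follows. The internal hom is $[M,N]=\mathrm{Hom}_k(M,N)$ with action $(a\cdot f)(m)=a_+f(a_-m)$. The unit object is $k$, with $A$ acting through $\varepsilon$. The structure maps are $i_M\colon[k,M]\to M$, $f\mapsto f(1)$; $j_M\colon k\to[M,M]$, $1\mapsto\mathrm{id}_M$; and $\Gamma^X_{Y,Z}\colon[Y,Z]\to[[X,Y],[X,Z]]$, $f\mapsto f\circ-$. This structure is called left normal if for all left $A$-modules $X,Y$ the natural map $$\mathrm{Hom}_A(X,Y)\to\mathrm{Hom}_A(k,[X,Y]),\qquad f\mapsto[f,Y]\circ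 j_Y,$$ is a bijection. Proposition. Let $A$ be a gabi-algebra whose canonical map $\beta\colon A\otimes_k A\to A\otimes_k A$, $\beta(a\otimes b)=a_+\otimes a_-b$, is invertible. Then the skew-closed structure on $A\text{-}\mathrm{Mod}$ is left normal if and only if the algebra $A$ is a Hopf algebra over $k$ with comultiplication $a\mapsto\beta^{-1}(a\otimes 1)$, counit $\varepsilon$ and antipode $\sigma(a)=\varepsilon(a_+)a_-$. -/

import Mathlib

open CategoryTheory Opposite
open scoped TensorProduct

universe v u

/-! ### Skew-closed categories -/

section SkewClosed

variable {C : Type u} [Category.{v} C]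

/-- The object `[X, Y]` of an internal-hom functor `H : Cᵒᵖ ⥤ C ⥤ C`. -/
abbrev innerHom (H : Cᵒᵖ ⥤ C ⥤ C) (X Y : C) : C := (H.obj (op X)).obj Y

/-- The morphism `[f, Z] : [Y, Z] ⟶ [X, Z]` induced by `f : X ⟶ Y`. -/
abbrev innerPre (H : Cᵒᵖ ⥤ C ⥤ C) {X Y : C} (f : X ⟶ Y) (Z : C) :
    innerHom H Y Z ⟶ innerHom H X Z := (H.map f.op).app Z

/-- The morphism `[X, g] : [X, Y] ⟶ [X, Z]` induced by `g : Y ⟶ Z`. -/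
abbrev innerPost (H : Cᵒᵖ ⥤ C ⥤ C) (X : C) {Y Z : C} (g : Y ⟶ Z) :
    innerHom H X Y ⟶ innerHom H X Z := (H.obj (op X)).map g

end SkewClosed

/-- A (left) skew-closed structure on a category `C`. -/
structure SkewClosed (C : Type u) [Category.{v} C] where
  /-- the unit object `𝟏` -/
  unit : C
  /-- the internal hom `[-, -]` -/
  ihom : Cᵒᵖ ⥤ C ⥤ C
  /-- the natural transformation `i : [𝟏, -] ⟹ -` -/
  i : ihom.obj (op unit) ⟶ 𝟭 C
  /-- the dinatural transformation `j : 𝟏 ⟶ [-, -]` -/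
  j (X : C) : unit ⟶ innerHom ihom X X
  j_dinatural {X Y : C} (f : X ⟶ Y) :
    j X ≫ innerPost ihom X f = j Y ≫ innerPre ihom f Y
  /-- the family `Γ X Y Z : [Y, Z] ⟶ [[X, Y], [X, Z]]` -/
  Γ (X Y Z : C) : innerHom ihom Y Z ⟶ innerHom ihom (innerHom ihom X Y) (innerHom ihom X Z)
  Γ_natural_left (X : C) {Y Y' : C} (f : Y ⟶ Y') (Z : C) :
    innerPre ihom f Z ≫ Γ X Y Z =
      Γ X Y' Z ≫ innerPre ihom (innerPost ihom X f) (innerHom ihom X Z)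
  Γ_natural_right (X Y : C) {Z Z' : C} (g : Z ⟶ Z') :
    innerPost ihom Y g ≫ Γ X Y Z' =
      Γ X Y Z ≫ innerPost ihom (innerHom ihom X Y) (innerPost ihom X g)
  Γ_dinatural {X X' : C} (f : X ⟶ X') (Y Z : C) :
    Γ X Y Z ≫ innerPre ihom (innerPre ihom f Y) (innerHom ihom X Z) =
      Γ X' Y Z ≫ innerPost ihom (innerHom ihom X' Y) (innerPre ihom f Z)
  j_i : j unit ≫ i.app unit = 𝟙 unit
  Γ_j_i (X Y : C) :
    Γ X X Y ≫ innerPre ihom (j X) (innerHom ihom X Y) ≫ i.app (innerHom ihom X Y) =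
      𝟙 (innerHom ihom X Y)
  j_Γ (X Y : C) : j Y ≫ Γ X Y Y = j (innerHom ihom X Y)
  Γ_i (X Y : C) :
    Γ unit X Y ≫ innerPost ihom (innerHom ihom unit X) (i.app Y) = innerPre ihom (i.app X) Y
  Γ_Γ (U V W X : C) :
    Γ U W X ≫ Γ (innerHom ihom U V) (innerHom ihom U W) (innerHom ihom U X) ≫
        innerPre ihom (Γ U V W) (innerHom ihom (innerHom ihom U V) (innerHom ihom U X)) =
      Γ V W X ≫ innerPost ihom (innerHom ihom V W) (Γ U V X)

namespace SkewClosed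

variable {C : Type u} [Category.{v} C] (S : SkewClosed C)

/-- The map `C(X, Y) → C(𝟏, [X, Y])`, `f ↦ [f, Y] ∘ j_Y`. -/
def leftNormalMap (X Y : C) (f : X ⟶ Y) : S.unit ⟶ innerHom S.ihom X Y :=
  S.j Y ≫ innerPre S.ihom f Y

theorem leftNormalMap_natural {X X' Y Y' : C} (h : X' ⟶ X) (f : X ⟶ Y) (g : Y ⟶ Y') :
    S.leftNormalMap X' Y' (h ≫ f ≫ g) =
      S.leftNormalMap X Y f ≫ innerPre S.ihom h Y ≫ innerPost S.ihom X' g := by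
  have e := S.j_dinatural g
  simp only [leftNormalMap, innerPre, innerPost, op_comp, Functor.map_comp, NatTrans.comp_app,
    Category.assoc] at e ⊢
  rw [← reassoc_of% e]
  simp

/-- Left normality: the maps `C(X, Y) → C(𝟏, [X, Y])` are bijections (naturality is automatic,
see `leftNormalMap_natural`). -/
def LeftNormal : Prop := ∀ X Y : C, Function.Bijective (S.leftNormalMap X Y)

end SkewClosed

/-! ### Gabi-algebras -/

noncomputable section

section Gabi

variable {k A : Type u} [CommRing k] [Ring A] [Algebra k A]

/-- For `δ : A → A ⊗ Aᵒᵖ`, the linear map `A → A ⊗ A`, `a ↦ a₊ ⊗ a₋`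
(that is, `δ` with the second tensor factor regarded as an element of `A`). -/
def plusMinus (δ : A →ₐ[k] A ⊗[k] Aᵐᵒᵖ) : A →ₗ[k] A ⊗[k] A :=
  ((MulOpposite.opLinearEquiv k (M := A)).symm.toLinearMap.lTensor A) ∘ₗ δ.toLinearMap

variable (k A) in
/-- The linear map `(x ⊗ y) ⊗ (z ⊗ w) ↦ (x ⊗ z) ⊗ w y`. -/
def gabiShuffle : (A ⊗[k] A) ⊗[k] (A ⊗[k] A) →ₗ[k] (A ⊗[k] A) ⊗[k] A :=
  ((LinearMap.mul' k A ∘ₗ (TensorProduct.comm k A A).toLinearMap).lTensor (A ⊗[k] A)) ∘ₗ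
    (TensorProduct.tensorTensorTensorComm k A A A A).toLinearMap

variable (k A) in
/-- A (left) gabi-algebra structure on a `k`-algebra `A`. -/
structure GabiAlgebra where
  /-- the augmentation -/
  ε : A →ₐ[k] k
  /-- the algebra map `a ↦ a₊ ⊗ a₋` -/
  δ : A →ₐ[k] A ⊗[k] Aᵐᵒᵖ
  /-- `a₊ ε(a₋) = a` -/
  ga1 (a : A) : TensorProduct.rid k A (ε.toLinearMap.lTensor A (plusMinus δ a)) = a
  /-- `a₊ a₋ = ε(a) 1` -/
  ga2 (a : A) : LinearMap.mul' k A (plusMinus δ a) = algebraMap k A (ε a)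
  /-- `a₊₊ ⊗ a₋₊ ⊗ a₋₋ a₊₋ = a₊ ⊗ a₋ ⊗ 1` -/
  ga3 (a : A) : gabiShuffle k A
      (TensorProduct.map (plusMinus δ) (plusMinus δ) (plusMinus δ a)) = plusMinus δ a ⊗ₜ[k] 1

end Gabi

namespace GabiAlgebra

section Maps

variable {k A : Type u} [CommRing k] [Ring A] [Algebra k A] (G : GabiAlgebra k A)

/-- The map `a ↦ a₊ ⊗ a₋` with values in `A ⊗ A`. -/
def pm : A →ₗ[k] A ⊗[k] A := plusMinus G.δ

/-- The canonical map `β(a ⊗ b) = a₊ ⊗ a₋ b`. -/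
def β : A ⊗[k] A →ₗ[k] A ⊗[k] A :=
  (LinearMap.mul' k A).lTensor A ∘ₗ (TensorProduct.assoc k A A A).toLinearMap ∘ₗ
    G.pm.rTensor A

/-- The map `a ↦ β⁻¹(a ⊗ 1)`, for invertible `β`. -/
def comul (hβ : Function.Bijective G.β) : A →ₗ[k] A ⊗[k] A :=
  (LinearEquiv.ofBijective G.β hβ).symm.toLinearMap ∘ₗ (TensorProduct.mk k A A).flip 1

/-- The antipode `σ(a) = ε(a₊) a₋`. -/
def antipode : A →ₗ[k] A :=
  (TensorProduct.lid k A).toLinearMap ∘ₗ G.ε.toLinearMap.rTensor A ∘ₗ G.pm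

end Maps

/-! ### The skew-closed structure on the category of modules over a gabi-algebra -/

section Modules

variable {k A : Type u} [CommRing k] [Ring A] [Algebra k A]

variable (k) in
/-- The underlying `k`-module of an `A`-module. -/
abbrev baseModule (M : ModuleCat.{u} A) : Module k M := Module.restrictScalars k A M

attribute [local instance] baseModule

variable (k) in
theorem base_isScalarTower (M : ModuleCat.{u} A) : IsScalarTower k A M :=
  IsScalarTower.restrictScalars k A M

attribute [local instance] base_isScalarTower

variable (k) in
/-- Action of `a ∈ A` on the target of `k`-linear maps. -/
def postAct (M N : ModuleCat.{u} A) : A →ₐ[k] Module.End k (M →ₗ[k] N) :=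
  AlgHom.ofLinearMap
    { toFun := fun a => LinearMap.llcomp k M N N (Algebra.lsmul k k N a)
      map_add' := fun a b => by ext f m; simp
      map_smul' := fun c a => by ext f m; simp }
    (by ext f m; simp) (fun a b => by ext f m; simp)

variable (k) in
/-- Action of `Aᵒᵖ` on the source of `k`-linear maps. -/
def preAct (M N : ModuleCat.{u} A) : Aᵐᵒᵖ →ₐ[k] Module.End k (M →ₗ[k] N) :=
  AlgHom.ofLinearMap
    { toFun := fun a => LinearMap.lcomp k N (Algebra.lsmul k k M a.unop)
      map_add' := fun a b => by ext f m; simp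
      map_smul' := fun c a => by ext f m; simp }
    (by ext f m; simp) (fun a b => by ext f m; simp)

variable (k) in
/-- The action `((x ⊗ y) • f) m = x f(y m)` of `A ⊗ Aᵒᵖ` on `Hom_k(M, N)`. -/
def homAct (M N : ModuleCat.{u} A) : A ⊗[k] Aᵐᵒᵖ →ₐ[k] Module.End k (M →ₗ[k] N) :=
  Algebra.TensorProduct.lift (postAct k M N) (preAct k M N)
    (fun x y => by ext f m; simp [postAct, preAct])

variable (G : GabiAlgebra k A)

/-- The `k`-module `k` with `A` acting through `ε`; a type synonym of `k`. -/
def UnitCarrier (_ : GabiAlgebra k A) : Type u := k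

instance : AddCommGroup G.UnitCarrier := inferInstanceAs (AddCommGroup k)

instance : Module A G.UnitCarrier := Module.compHom k G.ε.toRingHom

/-- `Hom_k(M, N)` with `A` acting by `(a • f) m = a₊ f(a₋ m)`; a type synonym
of `M →ₗ[k] N`. -/
def HomCarrier (_ : GabiAlgebra k A) (M N : ModuleCat.{u} A) : Type u := M →ₗ[k] N

instance (M N : ModuleCat.{u} A) : AddCommGroup (G.HomCarrier M N) :=
  inferInstanceAs (AddCommGroup (M →ₗ[k] N))

instance (M N : ModuleCat.{u} A) : Module A (G.HomCarrier M N) :=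
  Module.compHom (M →ₗ[k] N) ((homAct k M N).comp G.δ).toRingHom

/-- The unit object `k` of the category of `A`-modules. -/
def unitObj : ModuleCat.{u} A := ModuleCat.of A G.UnitCarrier

/-- The internal hom object `[M, N] = Hom_k(M, N)`. -/
def homObj (M N : ModuleCat.{u} A) : ModuleCat.{u} A := ModuleCat.of A (G.HomCarrier M N)

/-- An element of `[M, N]` as a `k`-linear map. -/
def asLinear {M N : ModuleCat.{u} A} : G.homObj M N ≃+ (M →ₗ[k] N) := AddEquiv.refl _

/-- The element of `k` given by an element of the unit object. -/
def asScalar : G.unitObj ≃+ k := AddEquiv.refl _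

/-- `x ⊗ y ↦ x f(y m)`. -/
def sandwich {M N : ModuleCat.{u} A} (f : M →ₗ[k] N) (m : M) : A ⊗[k] A →ₗ[k] N :=
  TensorProduct.lift (LinearMap.mk₂ k (fun x y => x • f (y • m))
    (by intros; simp [add_smul]) (by intros; simp) (by intros; simp [add_smul])
    (by intro c x y; simp only [smul_assoc, map_smul]; rw [smul_comm]))

theorem sandwich_tmul {M N : ModuleCat.{u} A} (f : M →ₗ[k] N) (m : M) (x y : A) :
    sandwich f m (x ⊗ₜ[k] y) = x • f (y • m) := rfl

/-- `(a • f) m = a₊ f(a₋ m)`. -/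
theorem smul_apply {M N : ModuleCat.{u} A} (a : A) (f : G.homObj M N) (m : M) :
    G.asLinear (a • f) m = sandwich (G.asLinear f) m (G.pm a) := by
  have key : ∀ t : A ⊗[k] Aᵐᵒᵖ, (homAct k M N t (G.asLinear f)) m =
      sandwich (G.asLinear f) m
        (((MulOpposite.opLinearEquiv k (M := A)).symm.toLinearMap.lTensor A) t) := by
    intro t
    induction t with
    | zero => simp
    | add s t hs ht => simp only [map_add, LinearMap.add_apply, hs, ht]
    | tmul x y => rfl
  exact key (G.δ a)

theorem smul_unit (a : A) (c : G.unitObj) : G.asScalar (a • c) = G.ε a * G.asScalar c := rfl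

theorem base_smul_unit (r : k) (c : G.unitObj) : G.asScalar (r • c) = r * G.asScalar c := by
  change G.ε (algebraMap k A r) * G.asScalar c = _
  simp

theorem pm_one : G.pm 1 = 1 ⊗ₜ[k] 1 := by
  simp [pm, plusMinus, Algebra.TensorProduct.one_def]

theorem base_smul_apply {M N : ModuleCat.{u} A} (r : k) (f : G.homObj M N) (m : M) :
    G.asLinear (r • f) m = r • G.asLinear f m := by
  change G.asLinear (algebraMap k A r • f) m = _
  rw [smul_apply, Algebra.algebraMap_eq_smul_one, map_smul, pm_one, map_smul, sandwich_tmul]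
  simp

theorem hom_ext {M N : ModuleCat.{u} A} {f g : G.homObj M N}
    (h : ∀ m, G.asLinear f m = G.asLinear g m) : f = g :=
  G.asLinear.injective (LinearMap.ext h)

/-- The linear map underlying `postHom`. -/
def postLin (X : ModuleCat.{u} A) {Y Z : ModuleCat.{u} A} (g : Y ⟶ Z) :
    G.homObj X Y →ₗ[A] G.homObj X Z :=
  { toFun := fun f => G.asLinear.symm (g.hom.restrictScalars k ∘ₗ G.asLinear f)
    map_add' := fun f f' => by
      apply G.hom_ext; intro m; simp
    map_smul' := fun a f => by
      apply G.hom_ext; intro m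
      simp only [AddEquiv.apply_symm_apply, LinearMap.comp_apply, smul_apply, RingHom.id_apply]
      generalize G.pm a = t
      induction t with
      | zero => simp
      | add s t hs ht => simp only [map_add, hs, ht]
      | tmul x y => simp [sandwich_tmul] }

/-- `[X, g]`: post-composition with an `A`-linear map. -/
def postHom (X : ModuleCat.{u} A) {Y Z : ModuleCat.{u} A} (g : Y ⟶ Z) :
    G.homObj X Y ⟶ G.homObj X Z :=
  ModuleCat.ofHom (G.postLin X g)

/-- The linear map underlying `preHom`. -/
def preLin {X Y : ModuleCat.{u} A} (f : X ⟶ Y) (Z : ModuleCat.{u} A) :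
    G.homObj Y Z →ₗ[A] G.homObj X Z :=
  { toFun := fun g => G.asLinear.symm (G.asLinear g ∘ₗ f.hom.restrictScalars k)
    map_add' := fun g g' => by
      apply G.hom_ext; intro m; simp
    map_smul' := fun a g => by
      apply G.hom_ext; intro m
      simp only [AddEquiv.apply_symm_apply, LinearMap.comp_apply, smul_apply, RingHom.id_apply]
      generalize G.pm a = t
      induction t with
      | zero => simp
      | add s t hs ht => simp only [map_add, hs, ht]
      | tmul x y => simp [sandwich_tmul] }

/-- `[f, Z]`: pre-composition with an `A`-linear map. -/
def preHom {X Y : ModuleCat.{u} A} (f : X ⟶ Y) (Z : ModuleCat.{u} A) :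
    G.homObj Y Z ⟶ G.homObj X Z :=
  ModuleCat.ofHom (G.preLin f Z)

theorem postHom_apply (X : ModuleCat.{u} A) {Y Z : ModuleCat.{u} A} (g : Y ⟶ Z)
    (f : G.homObj X Y) (m : X) :
    G.asLinear ((G.postHom X g).hom f) m = g.hom (G.asLinear f m) := rfl

theorem preHom_apply {X Y : ModuleCat.{u} A} (f : X ⟶ Y) (Z : ModuleCat.{u} A)
    (g : G.homObj Y Z) (m : X) :
    G.asLinear ((G.preHom f Z).hom g) m = G.asLinear g (f.hom m) := rfl

/-- The internal hom functor `[M, N] = Hom_k(M, N)`. -/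
def ihomFunctor : (ModuleCat.{u} A)ᵒᵖ ⥤ ModuleCat.{u} A ⥤ ModuleCat.{u} A where
  obj X :=
    { obj := fun Y => G.homObj X.unop Y
      map := fun g => G.postHom X.unop g
      map_id := fun _ => rfl
      map_comp := fun _ _ => rfl }
  map f :=
    { app := fun Z => G.preHom f.unop Z
      naturality := fun _ _ _ => rfl }
  map_id _ := rfl
  map_comp _ _ := rfl

/-- The linear map underlying `iMap`. -/
def iLin (M : ModuleCat.{u} A) :
    G.homObj G.unitObj M →ₗ[A] M :=
  { toFun := fun f => G.asLinear f (G.asScalar.symm 1)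
    map_add' := fun f f' => by simp
    map_smul' := fun a f => by
      rw [smul_apply, RingHom.id_apply]
      conv_rhs => rw [← G.ga1 a]
      change _ = (TensorProduct.rid k A (G.ε.toLinearMap.lTensor A (G.pm a))) • _
      generalize G.pm a = t
      induction t with
      | zero => simp
      | add s t hs ht => simp only [map_add, add_smul, hs, ht]
      | tmul x y =>
        have h : y • G.asScalar.symm 1 = G.ε y • G.asScalar.symm (1 : k) := by
          apply G.asScalar.injective
          rw [smul_unit, base_smul_unit]
        rw [sandwich_tmul, h, map_smul]
        simp [smul_comm x] }

/-- `i_M : [k, M] ⟶ M`, `f ↦ f 1`. -/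
def iMap (M : ModuleCat.{u} A) : G.homObj G.unitObj M ⟶ M :=
  ModuleCat.ofHom (G.iLin M)

/-- The linear map underlying `jMap`. -/
def jLin (M : ModuleCat.{u} A) :
    G.unitObj →ₗ[A] G.homObj M M :=
  { toFun := fun c => G.asLinear.symm (G.asScalar c • LinearMap.id)
    map_add' := fun c d => by
      apply G.hom_ext; intro m; simp [add_smul]
    map_smul' := fun a c => by
      apply G.hom_ext; intro m
      rw [RingHom.id_apply, smul_apply, smul_unit]
      simp only [AddEquiv.apply_symm_apply, LinearMap.smul_apply, LinearMap.id_apply]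
      rw [mul_comm, mul_smul, ← algebraMap_smul A (G.ε a) m, ← G.ga2 a]
      change G.asScalar c • LinearMap.mul' k A (G.pm a) • m = _
      generalize G.pm a = t
      induction t with
      | zero => simp
      | add s t hs ht => simp only [map_add, add_smul, smul_add, hs, ht]
      | tmul x y => simp [sandwich_tmul, mul_smul, smul_comm x] }

/-- `j_M : k ⟶ [M, M]`, `c ↦ c • id_M`. -/
def jMap (M : ModuleCat.{u} A) : G.unitObj ⟶ G.homObj M M :=
  ModuleCat.ofHom (G.jLin M)

theorem sandwich_add {M N : ModuleCat.{u} A} (f : M →ₗ[k] N) (m m' : M) (t : A ⊗[k] A) :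
    sandwich f (m + m') t = sandwich f m t + sandwich f m' t := by
  induction t with
  | zero => simp
  | add s t hs ht => simp only [map_add, hs, ht]; abel
  | tmul x y => simp [sandwich_tmul]

theorem sandwich_smul {M N : ModuleCat.{u} A} (f : M →ₗ[k] N) (r : k) (m : M) (t : A ⊗[k] A) :
    sandwich f (r • m) t = r • sandwich f m t := by
  induction t with
  | zero => simp
  | add s t hs ht => simp only [map_add, smul_add, hs, ht]
  | tmul x y => simp [sandwich_tmul, smul_comm _ r]

/-- `(x ⊗ y) ⊗ z ↦ x f(y g(z m))`. -/
def sandwich₂ {X Y Z : ModuleCat.{u} A} (f : Y →ₗ[k] Z) (g : X →ₗ[k] Y) (m : X) :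
    (A ⊗[k] A) ⊗[k] A →ₗ[k] Z :=
  TensorProduct.lift (LinearMap.mk₂ k (fun t z => sandwich f (g (z • m)) t)
    (by intros; simp) (by intros; simp)
    (by intros; simp [add_smul, sandwich_add]) (by intros; simp [sandwich_smul]))

theorem sandwich₂_tmul {X Y Z : ModuleCat.{u} A} (f : Y →ₗ[k] Z) (g : X →ₗ[k] Y) (m : X)
    (t : A ⊗[k] A) (z : A) :
    sandwich₂ f g m (t ⊗ₜ[k] z) = sandwich f (g (z • m)) t := rfl

theorem sandwich_shuffle {X Y Z : ModuleCat.{u} A} (f : Y →ₗ[k] Z) (g : G.homObj X Y) (y : A)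
    (s : A ⊗[k] A) (m : X) :
    sandwich (f ∘ₗ G.asLinear (y • g)) m s =
      sandwich₂ f (G.asLinear g) m (gabiShuffle k A (s ⊗ₜ[k] G.pm y)) := by
  induction s with
  | zero => simp
  | add s t hs ht => simp only [map_add, TensorProduct.add_tmul, hs, ht]
  | tmul p q =>
    rw [sandwich_tmul, LinearMap.comp_apply, smul_apply]
    generalize G.pm y = r
    induction r with
    | zero => simp
    | add s t hs ht => simp only [map_add, TensorProduct.tmul_add, smul_add, hs, ht]
    | tmul v w => simp [gabiShuffle, sandwich₂_tmul, sandwich_tmul, mul_smul]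

/-- Composition with a fixed `k`-linear map `f`, as a `k`-linear map `[X, Y] → [X, Z]`. -/
def compLin (X : ModuleCat.{u} A) {Y Z : ModuleCat.{u} A} (f : Y →ₗ[k] Z) :
    G.homObj X Y →ₗ[k] G.homObj X Z where
  toFun g := G.asLinear.symm (f ∘ₗ G.asLinear g)
  map_add' g g' := by
    apply G.hom_ext; intro m; simp
  map_smul' r g := by
    apply G.hom_ext; intro m
    simp [base_smul_apply]

theorem sandwich_compLin {X Y Z : ModuleCat.{u} A} (f : Y →ₗ[k] Z) (g : G.homObj X Y)
    (m : X) (t : A ⊗[k] A) :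
    G.asLinear (sandwich (G.compLin X f) g t) m =
      sandwich₂ f (G.asLinear g) m (gabiShuffle k A (TensorProduct.map G.pm G.pm t)) := by
  induction t with
  | zero => simp
  | add s t hs ht => simp only [map_add, LinearMap.add_apply, hs, ht]
  | tmul x y =>
    rw [sandwich_tmul, smul_apply, TensorProduct.map_tmul, ← sandwich_shuffle]
    rfl

/-- The linear map underlying `ΓMap`. -/
def ΓLin (X Y Z : ModuleCat.{u} A) :
    G.homObj Y Z →ₗ[A] G.homObj (G.homObj X Y) (G.homObj X Z) where
  toFun f := G.asLinear.symm (G.compLin X (G.asLinear f))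
  map_add' f f' := by
    apply G.hom_ext; intro g; apply G.hom_ext; intro m; rfl
  map_smul' a f := by
    apply G.hom_ext; intro g; apply G.hom_ext; intro m
    have h3 : gabiShuffle k A (TensorProduct.map G.pm G.pm (G.pm a)) = G.pm a ⊗ₜ[k] 1 := G.ga3 a
    rw [RingHom.id_apply, smul_apply, AddEquiv.apply_symm_apply, AddEquiv.apply_symm_apply,
      sandwich_compLin, h3, sandwich₂_tmul, one_smul]
    exact G.smul_apply a f (G.asLinear g m)

/-- `Γ : [Y, Z] ⟶ [[X, Y], [X, Z]]`, `f ↦ f ∘ -`. -/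
def ΓMap (X Y Z : ModuleCat.{u} A) :
    G.homObj Y Z ⟶ G.homObj (G.homObj X Y) (G.homObj X Z) :=
  ModuleCat.ofHom (G.ΓLin X Y Z)

/-- The skew-closed structure on the category of `A`-modules that lifts the closed structure
of the category of `k`-modules: the underlying `k`-module of `[M, N]` is `Hom_k(M, N)`, the
underlying `k`-module of the unit is `k`, and `i`, `j`, `Γ` are given by evaluation at `1`,
by the identity, and by composition. -/
def skewClosed : SkewClosed (ModuleCat.{u} A) where
  unit := G.unitObj
  ihom := G.ihomFunctor
  i :=
    { app := fun M => G.iMap M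
      naturality := fun _ _ _ => rfl }
  j M := G.jMap M
  j_dinatural {X Y} f := by
    ext c
    apply G.hom_ext; intro m
    exact (map_smul (f.hom.restrictScalars k) (G.asScalar c) m)
  Γ X Y Z := G.ΓMap X Y Z
  Γ_natural_left _ _ _ _ _ := rfl
  Γ_natural_right _ _ _ _ _ := rfl
  Γ_dinatural _ _ _ := rfl
  j_i := by
    ext c
    apply G.asScalar.injective
    refine (G.base_smul_unit (G.asScalar c) (G.asScalar.symm 1)).trans ?_
    simp
  Γ_j_i X Y := by
    ext f
    apply G.hom_ext; intro m
    change G.asLinear f ((1 : k) • m) = G.asLinear f m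
    rw [one_smul]
  j_Γ X Y := by
    ext c
    apply G.hom_ext; intro f; apply G.hom_ext; intro m
    exact (G.base_smul_apply (G.asScalar c) f m).symm
  Γ_i _ _ := rfl
  Γ_Γ _ _ _ _ := rfl

end Modules
end GabiAlgebra

/-- The `k`-algebra `A` is a Hopf algebra with comultiplication `Δ`, counit `e` and
antipode `S`. -/
def IsHopfAlgebraWith {k A : Type u} [CommRing k] [Ring A] [alg : Algebra k A]
    (Δ : A →ₗ[k] A ⊗[k] A) (e : A →ₗ[k] k) (S : A →ₗ[k] A) : Prop :=
  ∃ H : HopfAlgebra k A, H.toAlgebra = alg ∧ HEq H.comul Δ ∧ HEq H.counit e ∧ HEq H.antipode S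

end

/-! ### The comultiplication of a gabi-algebra with invertible canonical map -/

noncomputable section

namespace GabiAlgebra

/-! ### Right-linear extensions and the twisted product on `A ⊗ A`. -/

section Twist

variable {k A : Type u} [CommRing k] [Ring A] [Algebra k A]

/-! Write Δ(a) = β⁻¹(a ⊗ 1) and θ(a) = ε(a₁) a₂. Of the Hopf algebra axioms only the left counit law
θ = id can fail. Since β is right linear, its inverse is a ⊗ b ↦ Δ(a)(1 ⊗ b), so Δ(a₊)(1 ⊗ a₋) = a ⊗
1 (`twist_comul_pm`). With this identity, Δ is multiplicative because δ is (`comul_mul`), the right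
counit law comes from the first gabi axiom (`lTensor_counit_comul`), and coassociativity from the
third (`comul_coassoc`). Next a₁ ⊗ σ(a₂) = a₊ ⊗ a₋ (`lTensor_antipode_comul`), which turns the
second axiom into one antipode law; the other is ε ⊗ id applied to β(Δ(a)) = a ⊗ 1.

Left normality says that every g in Hom_k(X, Y) with a · g = ε(a) g is `A`-linear
(`leftNormal_iff`). For such g, a g(m) = g(θ(a) m), so θ = id suffices. Conversely, θ is an algebra
endomorphism, and the identity map from `A` to `A` with action twisted by θ is invariant; its
linearity forces θ = id. -/

/-- The right `A`-linear extension `a ⊗ b ↦ D(a) (1 ⊗ b)` of a linear map `D : A → A ⊗ A`. -/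
def twist (D : A →ₗ[k] A ⊗[k] A) : A ⊗[k] A →ₗ[k] A ⊗[k] A :=
  (LinearMap.mul' k A).lTensor A ∘ₗ (TensorProduct.assoc k A A A).toLinearMap ∘ₗ D.rTensor A

theorem lTensor_mul'_assoc (t : A ⊗[k] A) (b : A) :
    (LinearMap.mul' k A).lTensor A (TensorProduct.assoc k A A A (t ⊗ₜ[k] b)) =
      t * ((1 : A) ⊗ₜ[k] b) := by
  induction t with
  | zero => simp
  | add s t hs ht => simp only [TensorProduct.add_tmul, map_add, add_mul, hs, ht]
  | tmul x y => simp

theorem twist_tmul (D : A →ₗ[k] A ⊗[k] A) (a b : A) :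
    twist D (a ⊗ₜ[k] b) = D a * ((1 : A) ⊗ₜ[k] b) :=
  lTensor_mul'_assoc (D a) b

theorem twist_tmul_one (D : A →ₗ[k] A ⊗[k] A) (a : A) :
    twist D (a ⊗ₜ[k] 1) = D a := by
  rw [twist_tmul, ← Algebra.TensorProduct.one_def, mul_one]

theorem twist_mul (D : A →ₗ[k] A ⊗[k] A) (t : A ⊗[k] A) (b : A) :
    twist D (t * ((1 : A) ⊗ₜ[k] b)) = twist D t * ((1 : A) ⊗ₜ[k] b) := by
  induction t with
  | zero => simp
  | add s t hs ht => simp only [add_mul, map_add, hs, ht]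
  | tmul x y => simp [twist_tmul, mul_assoc]

/-- The bilinear map sending `p ⊗ q` and `x ⊗ y` to `x p ⊗ q y`. -/
def sandwichMul : A ⊗[k] A →ₗ[k] A ⊗[k] A →ₗ[k] A ⊗[k] A :=
  TensorProduct.lift ((TensorProduct.mapBilinear (.id k) A A A A).compl₁₂
    (LinearMap.mul k A).flip (LinearMap.mul k A))

theorem sandwichMul_tmul (p q x y : A) :
    sandwichMul (k := k) (p ⊗ₜ[k] q) (x ⊗ₜ[k] y) = (x * p) ⊗ₜ[k] (q * y) := rfl

/-- The factor q enters on the left of the second leg and b on the right, so the two operations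
commute by associativity. -/
theorem sandwichMul_mul (s t : A ⊗[k] A) (b : A) :
    sandwichMul s (t * ((1 : A) ⊗ₜ[k] b)) = sandwichMul s t * ((1 : A) ⊗ₜ[k] b) := by
  induction t with
  | zero => simp
  | add t t' h h' => simp only [add_mul, map_add, h, h']
  | tmul x y =>
    induction s with
    | zero => simp
    | add s s' h h' => simp only [add_mul, map_add, LinearMap.add_apply, h, h']
    | tmul p q => simp [sandwichMul_tmul, mul_assoc]

theorem sandwichMul_tmul_one (s : A ⊗[k] A) (a : A) :
    sandwichMul s (a ⊗ₜ[k] 1) = (a ⊗ₜ[k] (1 : A)) * s := by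
  induction s with
  | zero => simp
  | add s s' h h' => simp only [mul_add, map_add, LinearMap.add_apply, h, h']
  | tmul p q => simp [sandwichMul_tmul]

end Twist

/-! ### Multiplicativity of Δ, the inverse of β, and the right counit law. -/

section Comul

variable {k A : Type u} [CommRing k] [Ring A] [Algebra k A] (G : GabiAlgebra k A)

theorem twist_pm : twist G.pm = G.β := rfl

/-- Multiplicativity of δ, read in `A ⊗ A`: the opposite product reverses the second leg, giving
a₊b₊ ⊗ b₋a₋. -/
theorem pm_mul (a b : A) : G.pm (a * b) = sandwichMul (G.pm b) (G.pm a) := by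
  have key : ∀ s t : A ⊗[k] Aᵐᵒᵖ,
      (MulOpposite.opLinearEquiv k (M := A)).symm.toLinearMap.lTensor A (s * t) =
        sandwichMul ((MulOpposite.opLinearEquiv k (M := A)).symm.toLinearMap.lTensor A t)
          ((MulOpposite.opLinearEquiv k (M := A)).symm.toLinearMap.lTensor A s) := by
    intro s t
    induction s with
    | zero => simp
    | add s s' h h' => simp only [add_mul, map_add, h, h']
    | tmul x y =>
      induction t with
      | zero => simp
      | add t t' h h' => simp only [mul_add, map_add, LinearMap.add_apply, h, h']
      | tmul p q => simp [sandwichMul_tmul]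
  have h := key (G.δ a) (G.δ b)
  rw [← map_mul] at h
  exact h

theorem β_mul_tmul (t : A ⊗[k] A) (p q : A) :
    G.β (t * (p ⊗ₜ[k] q)) = sandwichMul (G.pm p) (G.β t) * ((1 : A) ⊗ₜ[k] q) := by
  induction t with
  | zero => simp
  | add s t hs ht => simp only [add_mul, map_add, hs, ht]
  | tmul c d =>
    rw [Algebra.TensorProduct.tmul_mul_tmul, ← twist_pm, twist_tmul, twist_tmul, pm_mul,
      sandwichMul_mul, mul_assoc, Algebra.TensorProduct.tmul_mul_tmul, one_mul]

variable (hβ : Function.Bijective G.β)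

theorem β_comul (a : A) : G.β (G.comul hβ a) = a ⊗ₜ[k] 1 :=
  (LinearEquiv.ofBijective G.β hβ).apply_symm_apply _

/-- The key to multiplicativity of Δ: under β, left multiplication by Δ(a) becomes left
multiplication by a ⊗ 1. Sandwiching a ⊗ 1 with p₊ ⊗ p₋ gives a p₊ ⊗ p₋, as the second leg is
trivial. -/
theorem β_comul_mul (a : A) (s : A ⊗[k] A) :
    G.β (G.comul hβ a * s) = (a ⊗ₜ[k] (1 : A)) * G.β s := by
  induction s with
  | zero => simp
  | add s t hs ht => simp only [mul_add, map_add, hs, ht]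
  | tmul p q =>
    rw [β_mul_tmul, β_comul, sandwichMul_tmul_one, mul_assoc, ← twist_pm, twist_tmul]

theorem comul_mul (a b : A) : G.comul hβ (a * b) = G.comul hβ a * G.comul hβ b := by
  apply hβ.injective
  rw [β_comul_mul, β_comul, β_comul]
  simp

theorem comul_one : G.comul hβ 1 = 1 := by
  apply hβ.injective
  rw [β_comul, Algebra.TensorProduct.one_def, ← twist_pm, twist_tmul_one, pm_one]

/-- The comultiplication `a ↦ β⁻¹(a ⊗ 1)` as an algebra map. -/
def comulHom : A →ₐ[k] A ⊗[k] A :=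
  AlgHom.ofLinearMap (G.comul hβ) (G.comul_one hβ) (G.comul_mul hβ)

/-- Both β and the extension of Δ are right linear, so it is enough that β(Δ(a)) = a ⊗ 1. -/
theorem β_twist_comul (t : A ⊗[k] A) : G.β (twist (G.comul hβ) t) = t := by
  induction t with
  | zero => simp
  | add s t hs ht => simp only [map_add, hs, ht]
  | tmul a b =>
    rw [twist_tmul, ← twist_pm, twist_mul, twist_pm, β_comul]
    simp

theorem twist_comul_β (t : A ⊗[k] A) : twist (G.comul hβ) (G.β t) = t :=
  hβ.injective (G.β_twist_comul hβ _)

theorem twist_comul_pm (a : A) : twist (G.comul hβ) (G.pm a) = a ⊗ₜ[k] 1 := by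
  rw [← twist_tmul_one G.pm, twist_pm, twist_comul_β]

/-- `a₊ ε(a₋ b) = a ε(b)`. -/
theorem rid_lTensor_β (t : A ⊗[k] A) :
    TensorProduct.rid k A (G.ε.toLinearMap.lTensor A (G.β t)) =
      TensorProduct.rid k A (G.ε.toLinearMap.lTensor A t) := by
  have key : ∀ (s : A ⊗[k] A) (b : A), TensorProduct.rid k A
      (G.ε.toLinearMap.lTensor A (s * ((1 : A) ⊗ₜ[k] b))) =
        G.ε b • TensorProduct.rid k A (G.ε.toLinearMap.lTensor A s) := by
    intro s b
    induction s with
    | zero => simp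
    | add s t hs ht => simp only [add_mul, map_add, smul_add, hs, ht]
    | tmul x y => simp [mul_smul, smul_comm (G.ε b)]
  induction t with
  | zero => simp
  | add s t hs ht => simp only [map_add, hs, ht]
  | tmul a b =>
    rw [← twist_pm, twist_tmul, key]
    -- After ε(b) is split off by multiplicativity of ε, what remains is the first gabi axiom.
    erw [G.ga1 a]
    simp

theorem lTensor_counit_comul (a : A) :
    G.ε.toLinearMap.lTensor A (G.comul hβ a) = a ⊗ₜ[k] 1 := by
  apply (TensorProduct.rid k A).injective
  rw [← rid_lTensor_β, β_comul]
  simp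

/-! ### Coassociativity. -/

/-- `a₊ ⊗ Δ(a₋) = a₊₊ ⊗ (a₋ ⊗ a₊₋)`. -/
theorem lTensor_comul_pm (a : A) :
    (G.comul hβ).lTensor A (G.pm a) =
      (TensorProduct.comm k A A).toLinearMap.lTensor A
        (TensorProduct.assoc k A A A (G.pm.rTensor A (G.pm a))) := by
  have hinj : Function.Injective (G.β.lTensor A) :=
    ((LinearEquiv.ofBijective G.β hβ).lTensor A).injective
  -- Under id ⊗ β the left side becomes a₊ ⊗ a₋ ⊗ 1 and the right side a₊₊ ⊗ a₋₊ ⊗ a₋₋a₊₋: the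
  -- identity is the third gabi axiom.
  apply hinj
  have h1 : ∀ t : A ⊗[k] A, G.β.lTensor A ((G.comul hβ).lTensor A t) =
      TensorProduct.assoc k A A A (t ⊗ₜ[k] 1) := by
    intro t
    induction t with
    | zero => simp
    | add s t hs ht => simp only [map_add, TensorProduct.add_tmul, hs, ht]
    | tmul x y => simp [β_comul]
  have h2 : ∀ (s : A ⊗[k] A) (y : A),
      G.β.lTensor A ((TensorProduct.comm k A A).toLinearMap.lTensor A
        (TensorProduct.assoc k A A A (s ⊗ₜ[k] y))) =
      TensorProduct.assoc k A A A (gabiShuffle k A (s ⊗ₜ[k] G.pm y)) := by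
    intro s y
    induction s with
    | zero => simp
    | add s t hs ht => simp only [map_add, TensorProduct.add_tmul, hs, ht]
    | tmul u v =>
      simp only [TensorProduct.assoc_tmul, LinearMap.lTensor_tmul, LinearEquiv.coe_coe,
        TensorProduct.comm_tmul]
      rw [← twist_pm, twist_tmul]
      generalize G.pm y = r
      induction r with
      | zero => simp
      | add s t hs ht => simp only [map_add, TensorProduct.tmul_add, add_mul, hs, ht]
      | tmul w z => simp [gabiShuffle]
  have h3 : ∀ t : A ⊗[k] A,
      G.β.lTensor A ((TensorProduct.comm k A A).toLinearMap.lTensor A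
        (TensorProduct.assoc k A A A (G.pm.rTensor A t))) =
      TensorProduct.assoc k A A A
        (gabiShuffle k A (TensorProduct.map G.pm G.pm t)) := by
    intro t
    induction t with
    | zero => simp
    | add s t hs ht => simp only [map_add, hs, ht]
    | tmul x y => rw [LinearMap.rTensor_tmul, h2, TensorProduct.map_tmul]
  rw [h1, h3]
  exact congrArg _ (G.ga3 a).symm

/-- The algebra map `(id ⊗ Δ) ∘ Δ`. -/
def comulTwice : A →ₐ[k] A ⊗[k] (A ⊗[k] A) :=
  (Algebra.TensorProduct.map (AlgHom.id k A) (G.comulHom hβ)).comp (G.comulHom hβ)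

theorem comulTwice_apply (a : A) :
    G.comulTwice hβ a = (G.comul hβ).lTensor A (G.comul hβ a) := rfl

/-- `x ⊗ v ↦ (id ⊗ Δ)(Δ(x)) (1 ⊗ 1 ⊗ v)`. -/
def comulTwiceRight : A ⊗[k] A →ₗ[k] A ⊗[k] (A ⊗[k] A) :=
  TensorProduct.lift ((LinearMap.mul k (A ⊗[k] (A ⊗[k] A))).compl₁₂
    (G.comulTwice hβ).toLinearMap
    (TensorProduct.mk k A (A ⊗[k] A) 1 ∘ₗ TensorProduct.mk k A A 1))

theorem comulTwiceRight_tmul (x v : A) : G.comulTwiceRight hβ (x ⊗ₜ[k] v) =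
    G.comulTwice hβ x * ((1 : A) ⊗ₜ[k] ((1 : A) ⊗ₜ[k] v)) := rfl

/-- `x ⊗ y ↦ D(x) (1 ⊗ y ⊗ 1)`. -/
def middleTwist (D : A →ₗ[k] A ⊗[k] (A ⊗[k] A)) : A ⊗[k] A →ₗ[k] A ⊗[k] (A ⊗[k] A) :=
  TensorProduct.lift ((LinearMap.mul k (A ⊗[k] (A ⊗[k] A))).compl₁₂ D
    (TensorProduct.mk k A (A ⊗[k] A) 1 ∘ₗ (TensorProduct.mk k A A).flip 1))

theorem middleTwist_tmul (D : A →ₗ[k] A ⊗[k] (A ⊗[k] A)) (x y : A) :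
    middleTwist D (x ⊗ₜ[k] y) = D x * ((1 : A) ⊗ₜ[k] (y ⊗ₜ[k] (1 : A))) := rfl

theorem middleTwist_mul (D : A →ₗ[k] A ⊗[k] (A ⊗[k] A)) (t : A ⊗[k] A) (b : A) :
    middleTwist D (t * ((1 : A) ⊗ₜ[k] b)) =
      middleTwist D t * ((1 : A) ⊗ₜ[k] (b ⊗ₜ[k] (1 : A))) := by
  induction t with
  | zero => simp
  | add s t hs ht => simp only [add_mul, map_add, hs, ht]
  | tmul x y => simp [middleTwist_tmul, mul_assoc]

theorem middleTwist_pm (a : A) :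
    middleTwist (G.comulTwiceRight hβ ∘ₗ G.pm) (G.pm a) = a ⊗ₜ[k] 1 := by
  -- both sides equal the image of `Δ(a₊) (1 ⊗ a₋) = a ⊗ 1` under `id ⊗ Δ`
  let F : A ⊗[k] (A ⊗[k] A) →ₗ[k] A ⊗[k] (A ⊗[k] A) :=
    TensorProduct.lift ((LinearMap.mul k (A ⊗[k] (A ⊗[k] A))).compl₁₂
      (G.comulTwice hβ).toLinearMap (TensorProduct.mk k A (A ⊗[k] A) 1))
  have hF : ∀ x s, F (x ⊗ₜ[k] s) = G.comulTwice hβ x * ((1 : A) ⊗ₜ[k] s) := fun _ _ => rfl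
  have h1 : ∀ t : A ⊗[k] A, F ((G.comul hβ).lTensor A t) =
      Algebra.TensorProduct.map (AlgHom.id k A) (G.comulHom hβ) (twist (G.comul hβ) t) := by
    intro t
    induction t with
    | zero => simp
    | add s t hs ht => simp only [map_add, hs, ht]
    | tmul x y =>
      rw [twist_tmul, map_mul, LinearMap.lTensor_tmul, hF, Algebra.TensorProduct.map_tmul, map_one]
      rfl
  have h2 : ∀ t : A ⊗[k] A,
      F ((TensorProduct.comm k A A).toLinearMap.lTensor A
        (TensorProduct.assoc k A A A (G.pm.rTensor A t))) =
      middleTwist (G.comulTwiceRight hβ ∘ₗ G.pm) t := by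
    intro t
    induction t with
    | zero => simp
    | add s t hs ht => simp only [map_add, hs, ht]
    | tmul x y =>
      rw [LinearMap.rTensor_tmul, middleTwist_tmul, LinearMap.comp_apply]
      generalize G.pm x = s
      induction s with
      | zero => simp
      | add s t hs ht => simp only [map_add, TensorProduct.add_tmul, add_mul, hs, ht]
      | tmul u v =>
        simp [hF, comulTwiceRight_tmul, mul_assoc]
  -- Writing Δ² for (id ⊗ Δ)Δ, the left side is Δ²(a₊₊)(1 ⊗ a₋ ⊗ a₊₋) = Δ²(a₊)(1 ⊗ Δ(a₋)), which is
  -- id ⊗ Δ applied to Δ(a₊)(1 ⊗ a₋) = a ⊗ 1.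
  rw [← h2, ← lTensor_comul_pm G hβ, h1, twist_comul_pm]
  simp

theorem middleTwist_β (t : A ⊗[k] A) :
    middleTwist (G.comulTwiceRight hβ ∘ₗ G.pm) (G.β t) =
      TensorProduct.assoc k A A A (t ⊗ₜ[k] 1) := by
  induction t with
  | zero => simp
  | add s t hs ht => simp only [map_add, TensorProduct.add_tmul, hs, ht]
  | tmul a b =>
    rw [← twist_pm, twist_tmul, middleTwist_mul, middleTwist_pm]
    simp

/-- Evaluate `middleTwist_β` at Δ(a): since β(Δ(a)) = a ⊗ 1, the middle factor disappears. -/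
theorem comulTwiceRight_pm (a : A) :
    G.comulTwiceRight hβ (G.pm a) =
      TensorProduct.assoc k A A A (G.comul hβ a ⊗ₜ[k] 1) := by
  rw [← middleTwist_β, β_comul, middleTwist_tmul, ← Algebra.TensorProduct.one_def,
    ← Algebra.TensorProduct.one_def, mul_one, LinearMap.comp_apply]

theorem comulTwiceRight_mul (t : A ⊗[k] A) (b : A) :
    G.comulTwiceRight hβ (t * ((1 : A) ⊗ₜ[k] b)) =
      G.comulTwiceRight hβ t * ((1 : A) ⊗ₜ[k] ((1 : A) ⊗ₜ[k] b)) := by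
  induction t with
  | zero => simp
  | add s t hs ht => simp only [add_mul, map_add, hs, ht]
  | tmul x y => simp [comulTwiceRight_tmul, mul_assoc]

theorem assoc_tmul_one_mul (t : A ⊗[k] A) (b : A) :
    TensorProduct.assoc k A A A (t ⊗ₜ[k] 1) * ((1 : A) ⊗ₜ[k] ((1 : A) ⊗ₜ[k] b)) =
      TensorProduct.assoc k A A A (t ⊗ₜ[k] b) := by
  induction t with
  | zero => simp
  | add s t hs ht => simp only [TensorProduct.add_tmul, map_add, add_mul, hs, ht]
  | tmul x y => simp

theorem comulTwiceRight_β (t : A ⊗[k] A) :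
    G.comulTwiceRight hβ (G.β t) =
      TensorProduct.assoc k A A A ((G.comul hβ).rTensor A t) := by
  induction t with
  | zero => simp
  | add s t hs ht => simp only [map_add, hs, ht]
  | tmul a b =>
    rw [← twist_pm, twist_tmul, comulTwiceRight_mul, comulTwiceRight_pm, assoc_tmul_one_mul,
      LinearMap.rTensor_tmul]

/-- Coassociativity. -/
theorem comul_coassoc (a : A) :
    TensorProduct.assoc k A A A ((G.comul hβ).rTensor A (G.comul hβ a)) =
      (G.comul hβ).lTensor A (G.comul hβ a) := by
  -- The same device again: `comulTwiceRight_β` at Δ(a) removes the last factor.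
  rw [← comulTwiceRight_β, β_comul, comulTwiceRight_tmul, ← Algebra.TensorProduct.one_def,
    ← Algebra.TensorProduct.one_def, mul_one, comulTwice_apply]

/-! ### The antipode. -/

/-- `a₁ ⊗ (a₂₊ ⊗ a₂₋) = a₊₁ ⊗ (a₊₂ ⊗ a₋)`. -/
theorem lTensor_pm_comul (a : A) :
    G.pm.lTensor A (G.comul hβ a) =
      TensorProduct.assoc k A A A ((G.comul hβ).rTensor A (G.pm a)) := by
  have hinj : Function.Injective (G.β.lTensor A) :=
    ((LinearEquiv.ofBijective G.β hβ).lTensor A).injective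
  have hγ : ∀ s, G.β.lTensor A ((twist (G.comul hβ)).lTensor A s) = s := by
    intro s
    have h : G.β ∘ₗ twist (G.comul hβ) = .id := LinearMap.ext (G.β_twist_comul hβ)
    rw [← LinearMap.comp_apply, ← LinearMap.lTensor_comp, h]
    simp
  -- Applying id ⊗ β⁻¹ sends the left side to Δ(a) ⊗ 1. By coassociativity the right side becomes Δ
  -- ⊗ id applied to Δ(a₊)(1 ⊗ a₋) = a ⊗ 1, which is the same element.
  apply (Function.LeftInverse.injective hγ)
  have h1 : ∀ t : A ⊗[k] A, (twist (G.comul hβ)).lTensor A (G.pm.lTensor A t) =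
      TensorProduct.assoc k A A A (t ⊗ₜ[k] 1) := by
    intro t
    induction t with
    | zero => simp
    | add s t hs ht => simp only [map_add, TensorProduct.add_tmul, hs, ht]
    | tmul x y => simp [twist_comul_pm]
  have h2 : ∀ (s : A ⊗[k] A) (y : A), (twist (G.comul hβ)).lTensor A
      (TensorProduct.assoc k A A A (s ⊗ₜ[k] y)) =
      (G.comul hβ).lTensor A s * ((1 : A) ⊗ₜ[k] ((1 : A) ⊗ₜ[k] y)) := by
    intro s y
    induction s with
    | zero => simp
    | add s t hs ht => simp only [map_add, TensorProduct.add_tmul, add_mul, hs, ht]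
    | tmul u v => simp [twist_tmul]
  have h3 : ∀ (s : A ⊗[k] A) (y : A),
      TensorProduct.assoc k A A A ((G.comul hβ).rTensor A s) *
        ((1 : A) ⊗ₜ[k] ((1 : A) ⊗ₜ[k] y)) =
      TensorProduct.assoc k A A A ((G.comul hβ).rTensor A (s * ((1 : A) ⊗ₜ[k] y))) := by
    intro s y
    induction s with
    | zero => simp
    | add s t hs ht => simp only [map_add, add_mul, hs, ht]
    | tmul u v =>
      simp only [LinearMap.rTensor_tmul, Algebra.TensorProduct.tmul_mul_tmul, mul_one]
      rw [← assoc_tmul_one_mul, ← assoc_tmul_one_mul _ (v * y), mul_assoc]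
      simp
  have h4 : ∀ t : A ⊗[k] A, (twist (G.comul hβ)).lTensor A
      (TensorProduct.assoc k A A A ((G.comul hβ).rTensor A t)) =
      TensorProduct.assoc k A A A ((G.comul hβ).rTensor A (twist (G.comul hβ) t)) := by
    intro t
    induction t with
    | zero => simp
    | add s t hs ht => simp only [map_add, hs, ht]
    | tmul x y =>
      rw [LinearMap.rTensor_tmul, h2, ← comul_coassoc, h3, twist_tmul]
  rw [h1, h4, twist_comul_pm, LinearMap.rTensor_tmul]

/-- `a₁ ⊗ σ(a₂) = a₊ ⊗ a₋`. -/
theorem lTensor_antipode_comul (a : A) :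
    G.antipode.lTensor A (G.comul hβ a) = G.pm a := by
  let E : A ⊗[k] A →ₗ[k] A := (TensorProduct.lid k A).toLinearMap ∘ₗ G.ε.toLinearMap.rTensor A
  have h1 : ∀ (s : A ⊗[k] A) (y : A), E.lTensor A (TensorProduct.assoc k A A A (s ⊗ₜ[k] y)) =
      (TensorProduct.rid k A (G.ε.toLinearMap.lTensor A s)) ⊗ₜ[k] y := by
    intro s y
    induction s with
    | zero => simp
    | add s t hs ht => simp only [map_add, TensorProduct.add_tmul, hs, ht]
    | tmul u v => simp [E, TensorProduct.smul_tmul]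
  have h2 : ∀ t : A ⊗[k] A, E.lTensor A
      (TensorProduct.assoc k A A A ((G.comul hβ).rTensor A t)) = t := by
    intro t
    induction t with
    | zero => simp
    | add s t hs ht => simp only [map_add, hs, ht]
    | tmul x y => simp [h1, lTensor_counit_comul]
  have h3 : G.antipode = E ∘ₗ G.pm := rfl
  -- Apply id ⊗ ε ⊗ id to `lTensor_pm_comul`; the right counit law collapses a₊₁ ε(a₊₂) to a₊.
  rw [h3, LinearMap.lTensor_comp, LinearMap.comp_apply, lTensor_pm_comul, h2]

theorem mul'_lTensor_antipode_comul (a : A) :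
    LinearMap.mul' k A (G.antipode.lTensor A (G.comul hβ a)) = algebraMap k A (G.ε a) := by
  rw [lTensor_antipode_comul]
  exact G.ga2 a

/-- Since σ(x) y = (ε ⊗ id)(β(x ⊗ y)), evaluation at Δ(a) gives (ε ⊗ id)(a ⊗ 1). -/
theorem mul'_rTensor_antipode_comul (a : A) :
    LinearMap.mul' k A (G.antipode.rTensor A (G.comul hβ a)) = algebraMap k A (G.ε a) := by
  let E : A ⊗[k] A →ₗ[k] A := (TensorProduct.lid k A).toLinearMap ∘ₗ G.ε.toLinearMap.rTensor A
  have h1 : ∀ (s : A ⊗[k] A) (b : A), E (s * ((1 : A) ⊗ₜ[k] b)) = E s * b := by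
    intro s b
    induction s with
    | zero => simp
    | add s t hs ht => simp only [add_mul, map_add, hs, ht]
    | tmul x y => simp [E]
  have h2 : ∀ t : A ⊗[k] A, LinearMap.mul' k A (G.antipode.rTensor A t) = E (G.β t) := by
    intro t
    induction t with
    | zero => simp
    | add s t hs ht => simp only [map_add, hs, ht]
    | tmul x y =>
      rw [← twist_pm, twist_tmul, h1]
      rfl
  rw [h2, β_comul]
  simp [E, Algebra.algebraMap_eq_smul_one]

/-! ### Reduction of the Hopf property to the left counit law. -/

/-- The Hopf algebra structure on a gabi-algebra with invertible canonical map whose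
comultiplication is left counital. -/
@[reducible] def hopfAlgebra (h : ∀ a, G.ε.toLinearMap.rTensor A (G.comul hβ a) = 1 ⊗ₜ[k] a) :
    HopfAlgebra k A where
  comul := G.comul hβ
  counit := G.ε.toLinearMap
  coassoc := LinearMap.ext (G.comul_coassoc hβ)
  rTensor_counit_comp_comul := LinearMap.ext h
  lTensor_counit_comp_comul := LinearMap.ext (G.lTensor_counit_comul hβ)
  counit_one := map_one G.ε
  mul_compr₂_counit := by ext a b; exact map_mul G.ε a b
  comul_one := G.comul_one hβ
  mul_compr₂_comul := by ext a b; exact G.comul_mul hβ a b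
  antipode := G.antipode
  mul_antipode_rTensor_comul := LinearMap.ext (G.mul'_rTensor_antipode_comul hβ)
  mul_antipode_lTensor_comul := LinearMap.ext (G.mul'_lTensor_antipode_comul hβ)

theorem isHopfAlgebraWith_iff :
    IsHopfAlgebraWith (G.comul hβ) G.ε.toLinearMap G.antipode ↔
      ∀ a, G.ε.toLinearMap.rTensor A (G.comul hβ a) = 1 ⊗ₜ[k] a := by
  constructor
  · rintro ⟨H, hA, h₁, h₂, -⟩
    -- Once the two algebra structures are identified, the heterogeneous equalities become ordinary
    -- ones.
    subst hA
    rw [← eq_of_heq h₁, ← eq_of_heq h₂]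
    exact fun a => H.rTensor_counit_comul a
  · exact fun h => ⟨G.hopfAlgebra hβ h, rfl, HEq.rfl, HEq.rfl, HEq.rfl⟩

end Comul
-- Left normality in terms of invariants.
section LeftNormal

variable {k A : Type u} [CommRing k] [Ring A] [Algebra k A] (G : GabiAlgebra k A)

attribute [local instance] baseModule base_isScalarTower

/-- The map f is recovered from its image by evaluating at 1; only surjectivity carries content in
left normality. -/
theorem leftNormalMap_injective (X Y : ModuleCat.{u} A) :
    Function.Injective (G.skewClosed.leftNormalMap X Y) := by
  intro f g h
  ext m
  have e : (1 : k) • f.hom m = (1 : k) • g.hom m :=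
    congrArg (fun φ => G.asLinear (φ.hom (G.asScalar.symm 1)) m) h
  rwa [one_smul, one_smul] at e

/-- The `A`-linear map `k → [X, Y]`, `c ↦ c g` given by an invariant element `g`. -/
def ofInvariant {X Y : ModuleCat.{u} A} (g : G.homObj X Y)
    (hg : ∀ a : A, a • g = G.ε a • g) : G.unitObj →ₗ[A] G.homObj X Y where
  toFun c := G.asScalar c • g
  map_add' c d := by rw [← add_smul]; rfl
  map_smul' a c := by
    rw [RingHom.id_apply, smul_comm a, hg, smul_smul, mul_comm]
    rfl

theorem eq_smul_one (c : G.unitObj) : c = G.asScalar c • G.asScalar.symm (1 : k) := by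
  apply G.asScalar.injective
  rw [base_smul_unit]
  simp

theorem unitHom_apply {M : ModuleCat.{u} A} (φ : G.unitObj →ₗ[A] M) (c : G.unitObj) :
    φ c = G.asScalar c • φ (G.asScalar.symm 1) := by
  conv_lhs => rw [G.eq_smul_one c]
  exact map_smul (φ.restrictScalars k) _ _

theorem unitHom_invariant {M : ModuleCat.{u} A} (φ : G.unitObj →ₗ[A] M) (a : A) :
    a • φ (G.asScalar.symm 1) = G.ε a • φ (G.asScalar.symm 1) := by
  rw [← map_smul, unitHom_apply, smul_unit]
  simp

/-- Left normality says that the invariants of `Hom_k(X, Y)` are `A`-linear. -/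
theorem leftNormal_iff : G.skewClosed.LeftNormal ↔
    ∀ (X Y : ModuleCat.{u} A) (g : G.homObj X Y), (∀ a : A, a • g = G.ε a • g) →
      ∀ (a : A) (m : X), G.asLinear g (a • m) = a • G.asLinear g m := by
  constructor
  · intro h X Y g hg a m
    obtain ⟨f, hf⟩ := (h X Y).surjective (ModuleCat.ofHom (G.ofInvariant g hg))
    have e : ∀ m, f.hom m = G.asLinear g m := by
      intro m
      have e : (1 : k) • f.hom m = G.asLinear ((1 : k) • g) m :=
        congrArg (fun φ => G.asLinear (φ.hom (G.asScalar.symm 1)) m) hf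
      rwa [one_smul, one_smul] at e
    rw [← e, ← e, map_smul]
  · intro h X Y
    refine ⟨G.leftNormalMap_injective X Y, fun φ => ?_⟩
    let ψ : G.unitObj →ₗ[A] G.homObj X Y := φ.hom
    refine ⟨ModuleCat.ofHom
      { toFun := G.asLinear (ψ (G.asScalar.symm 1))
        map_add' := map_add _
        map_smul' := h X Y _ (G.unitHom_invariant ψ) }, ?_⟩
    ext c
    apply G.hom_ext
    intro m
    change G.asScalar c • G.asLinear (ψ (G.asScalar.symm 1)) m = G.asLinear (ψ c) m
    rw [G.unitHom_apply ψ c, base_smul_apply]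

/-- A `k`-linear map between `A`-modules as an element of the internal hom. -/
def ofAddMonoidHom {X Y : ModuleCat.{u} A} (g : X →+ Y)
    (hg : ∀ (r : k) (m : X), g (algebraMap k A r • m) = algebraMap k A r • g m) :
    G.homObj X Y :=
  G.asLinear.symm { g with map_smul' := hg }

/-! ### The twisted regular module and the two implications. -/

variable (hβ : Function.Bijective G.β)

/-- The algebra map `a ↦ ε(a₁) a₂`. -/
def counitTwist : A →ₐ[k] A :=
  (Algebra.TensorProduct.lid k A).toAlgHom.comp
    ((Algebra.TensorProduct.map G.ε (AlgHom.id k A)).comp (G.comulHom hβ))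

theorem counitTwist_apply (a : A) : G.counitTwist hβ a =
    TensorProduct.lid k A (G.ε.toLinearMap.rTensor A (G.comul hβ a)) := rfl

/-- `A` as a module over itself through `a ↦ ε(a₁) a₂`; a type synonym of `A`. -/
def TwistedCarrier (_ : Function.Bijective G.β) : Type u := A

instance : AddCommGroup (G.TwistedCarrier hβ) := inferInstanceAs (AddCommGroup A)

instance : Module A (G.TwistedCarrier hβ) := Module.compHom A (G.counitTwist hβ).toRingHom

/-- The identity of `A` as a `k`-linear map to the twisted module. -/
def toTwisted : G.homObj (ModuleCat.of A A) (ModuleCat.of A (G.TwistedCarrier hβ)) :=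
  G.ofAddMonoidHom (AddMonoidHom.id A) (fun r a => by
    change algebraMap k A r * a = G.counitTwist hβ (algebraMap k A r) * a
    rw [AlgHom.commutes])

/-- With θ the twisting endomorphism, (a · id)(m) = θ(a₊) a₋ m, and θ(a₊) a₋ is ε ⊗ id applied to
Δ(a₊)(1 ⊗ a₋) = a ⊗ 1, that is, ε(a). -/
theorem toTwisted_invariant (a : A) : a • G.toTwisted hβ = G.ε a • G.toTwisted hβ := by
  apply G.hom_ext
  intro m
  rw [smul_apply, base_smul_apply]
  have h1 : ∀ s : A ⊗[k] A, ∀ y : A,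
      TensorProduct.lid k A (G.ε.toLinearMap.rTensor A (s * ((1 : A) ⊗ₜ[k] y))) =
        TensorProduct.lid k A (G.ε.toLinearMap.rTensor A s) * y := by
    intro s y
    induction s with
    | zero => simp
    | add s t hs ht => simp only [add_mul, map_add, hs, ht]
    | tmul u v => simp
  have h2 : ∀ t : A ⊗[k] A, sandwich (G.asLinear (G.toTwisted hβ)) m t =
      (TensorProduct.lid k A (G.ε.toLinearMap.rTensor A (twist (G.comul hβ) t)) * (m : A) : A) := by
    intro t
    induction t with
    | zero => rw [map_zero, map_zero, map_zero, map_zero, zero_mul]; rfl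
    | add s t hs ht => rw [map_add, hs, ht, map_add, map_add, map_add, add_mul]; rfl
    | tmul x y =>
      rw [twist_tmul, h1, sandwich_tmul, mul_assoc, ← counitTwist_apply]
      rfl
  rw [h2, twist_comul_pm]
  change TensorProduct.lid k A (G.ε.toLinearMap.rTensor A (a ⊗ₜ[k] (1 : A))) * (m : A) =
    G.counitTwist hβ (algebraMap k A (G.ε a)) * m
  rw [AlgHom.commutes]
  simp [Algebra.algebraMap_eq_smul_one]

theorem rTensor_counit_comul_of_leftNormal (h : G.skewClosed.LeftNormal) (a : A) :
    G.ε.toLinearMap.rTensor A (G.comul hβ a) = 1 ⊗ₜ[k] a := by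
  apply (TensorProduct.lid k A).injective
  -- Linearity of the identity map, tested at 1, reads a = ε(a₁) a₂.
  have e := G.leftNormal_iff.mp h _ _ (G.toTwisted hβ) (G.toTwisted_invariant hβ) a (1 : A)
  replace e : a * 1 = G.counitTwist hβ a * 1 := e
  rw [mul_one, mul_one] at e
  rw [← counitTwist_apply, ← e]
  simp

theorem sandwich_mul {M N : ModuleCat.{u} A} (f : M →ₗ[k] N) (m : M) (t : A ⊗[k] A) (b : A) :
    sandwich f m (t * ((1 : A) ⊗ₜ[k] b)) = sandwich f (b • m) t := by
  induction t with
  | zero => simp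
  | add s t hs ht => simp only [add_mul, map_add, hs, ht]
  | tmul x y => simp [sandwich_tmul, mul_smul]

theorem leftNormal_of_rTensor_counit_comul
    (h : ∀ a, G.ε.toLinearMap.rTensor A (G.comul hβ a) = 1 ⊗ₜ[k] a) :
    G.skewClosed.LeftNormal := by
  rw [leftNormal_iff]
  intro X Y g hg a m
  -- For t = x ⊗ y the left side is (x · g)(y m), which equals ε(x) g(y m) by invariance.
  have key : ∀ t : A ⊗[k] A, sandwich (G.asLinear g) m (G.β t) =
      G.asLinear g (TensorProduct.lid k A (G.ε.toLinearMap.rTensor A t) • m) := by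
    intro t
    induction t with
    | zero => simp
    | add s t hs ht => simp only [map_add, add_smul, hs, ht]
    | tmul x y =>
      rw [← twist_pm, twist_tmul, sandwich_mul, ← smul_apply, hg, base_smul_apply]
      simp
  -- At Δ(a) the left side is a g(m), because β(Δ(a)) = a ⊗ 1, and the right side is g(a m) by the
  -- left counit law.
  have e := key (G.comul hβ a)
  rw [β_comul, h, sandwich_tmul] at e
  simpa using e.symm

end LeftNormal

end GabiAlgebra

end

theorem proposition4p12 {k A : Type u} [CommRing k] [Ring A] [Algebra k A]
    (G : GabiAlgebra k A) (hβ : Function.Bijective G.β) :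
    G.skewClosed.LeftNormal ↔
      IsHopfAlgebraWith (G.comul hβ) G.ε.toLinearMap G.antipode := by
  rw [G.isHopfAlgebraWith_iff hβ]
  exact ⟨G.rTensor_counit_comul_of_leftNormal hβ, G.leftNormal_of_rTensor_counit_comul hβ⟩
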